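/- Let $I$ be a set. For an index set $J$, a \emph{$J$-partial algebra} is an associative, not necessarily unital, complex algebra with a vector space decomposition $A=\bigoplus_{p,q\in J}{}_pA_q$ such that ${}_pA_q\cdot{}_{q'}A_s=0$ for $q\ne q'$ and ${}_pA_q\cdot{}_qA_s\subseteq{}_pA_s$. Put $A_q=\bigoplus_p{}_pA_q$ and ${}_pA=\bigoplus_q{}_pA_q$. $A$ is \emph{non-degenerate} if $a\in A_q$, $aA_q=0$ imply $a=0$, and $a\in{}_pA$, ${}_pA\,a=0$ imply $a=0$; it is \emph{idempotent} if every $A_q$ and every ${}_pA$ is spanned by the products of its elements. For $J=I\times I$, write indices as columns $\binom rt$. For $\binom rt,\binom su\in J$ let ${}^r_tA^s_u$ be the component with left index $\binom rt$ and right index $\binom su$; omitted indices are summed over. Let $\mathbf 1^r,\mathbf 1_t\in M(A)$ (the multiplier algebra) be the idempotents that act as the projections onto the components with the indicated upper, respectively lower, left index (on left multiplication) or right index (on right multiplication), and let $E=\sum_t\mathbf 1_t\otimes\mathbf 1^t\in M(A\otimes A)$ (a strictly convergent sum). Let $A\otimes^IA=E(A\otimes A)E$, which is again an $I\times I$-partial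 algebra with components ${}^r_v(A\otimes^IA)^s_w=\bigoplus_{t,u}{}^r_tA^s_u\otimes{}^t_vA^u_w$. A \emph{regular $I$-partial multiplier Hopf algebra} is a non-degenerate idempotent $I\times I$-partial algebra $A$ with an algebra homomorphism $\Delta:A\to M(A\otimes^IA)\cong E\,M(A\otimes A)\,E$ and a linear functional $\varepsilon:A\to\mathbb C$ such that (a) $\Delta(a)(b\otimes1)$, $\Delta(a)(1\otimes b)$, $(b\otimes1)\Delta(a)$, $(1\otimes b)\Delta(a)$ are in $A\otimes A$ for all $a,b\in A$; $(A\otimes^IA)_q\,\Delta(A_q)=(A\otimes^IA)_q$ and $\Delta({}_pA)\,{}_p(A\otimes^IA)={}_p(A\otimes^IA)$ for all $p,q\in I\times I$; and $(\Delta\otimes\mathrm{id})\Delta=(\mathrm{id}\otimes\Delta)\Delta$ (for the extensions to multipliers); (b) $\varepsilon({}^r_tA^s_u)=0$ if $r\ne t$ or $s\ne u$; for every $r\in I$, $\varepsilon$ is non-zero on $A_r$ and on ${}_rA$ (lower index $r$); $\varepsilon(ab)=\varepsilon(a)\varepsilon(b)$ for $a\in A^s_t$, $b\in{}^s_tA$;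 and $(\mathrm{id}\otimes\varepsilon)\Delta(a)=a=(\varepsilon\otimes\mathrm{id})\Delta(a)$ for $a\in A$; (c) with single indices $r\in I$ in upper or lower position, the following four maps are bijective, where $\Delta^{\mathrm{op}}$ is $\Delta$ followed by the flip: $a\otimes b\mapsto\Delta(a)(1\otimes b)$ from $\bigoplus_rA_r\otimes{}_rA$ to $\bigoplus_r{}_rA\otimes{}^rA$; $a\otimes b\mapsto(a\otimes1)\Delta(b)$ from $\bigoplus_rA^r\otimes{}^rA$ to $\bigoplus_rA_r\otimes A^r$; $a\otimes b\mapsto\Delta^{\mathrm{op}}(a)(1\otimes b)$ from $\bigoplus_rA^r\otimes{}^rA$ to $\bigoplus_r{}^rA\otimes{}_rA$; $a\otimes b\mapsto(a\otimes1)\Delta^{\mathrm{op}}(b)$ from $\bigoplus_rA_r\otimes{}_rA$ to $\bigoplus_rA^r\otimes A_r$. An \emph{$I$-partial $*$-algebraic quantum group} is a regular $I$-partial multiplier Hopf algebra $A$ which is a $*$-algebra with $({}_pA_q)^*={}_qA_p$ for $p,q\in I\times I$, such that $\Delta$ is a $*$-homomorphism and such that there is a linear functional $\varphi:A\to\mathbb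 C$ that is - \emph{left invariant}: $\varphi$ vanishes on ${}_pA_q$ for $p\ne q$ in $I\times I$, and $(\mathrm{id}\otimes\varphi)\Delta(a)=\sum_r\varphi(\mathbf 1^ra)\mathbf 1^r=\sum_r\varphi(a\mathbf 1^r)\mathbf 1^r$ in $M(A)$ for all $a\in A$; - \emph{faithful}: $\varphi(aA)=0$ implies $a=0$, and $\varphi(Aa)=0$ implies $a=0$; - \emph{positive}: $\varphi(a^*a)\ge0$ for all $a\in A$. A \emph{unitary module} of $A$ is a complex pre-Hilbert space $V$ with an $A$-module structure such that $AV=V$ (where $AV$ is the span of the vectors $av$) and $\langle v,aw\rangle=\langle a^*v,w\rangle$ for $a\in A$, $v,w\in V$. A \emph{(bounded) $*$-representation} of $A$ is a Hilbert space $\mathcal H$ with a $*$-homomorphism $\pi:A\to B(\mathcal H)$ such that the span $A\mathcal H$ of the vectors $\pi(a)\xi$ is dense in $\mathcal H$. A \emph{completion} of the unitary module $V$ is a $*$-representation $(\mathcal H,\pi)$ with a linear isometry $j:V\to\mathcal H$ with dense range such that $\pi(a)j(v)=j(av)$ for all $a\in A$, $v\in V$. \textbf{Proposition.} Let $A$ be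 an $I$-partial $*$-algebraic quantum group and let $V$ be a unitary module of $A$. Then $A$ acts by bounded operators on $V$: for every $a\in A$ there is a constant $C$ with $\|av\|\le C\|v\|$ for all $v\in V$. Consequently, $V$ completes in a unique way to a $*$-representation: there is exactly one $*$-representation of $A$ on the Hilbert space completion of $V$ that extends the action on $V$, and for any two completions $(\mathcal H_1,\pi_1,j_1)$ and $(\mathcal H_2,\pi_2,j_2)$ of $V$ there is exactly one unitary $U:\mathcal H_1\to\mathcal H_2$ with $Uj_1=j_2$ and $U\pi_1(a)=\pi_2(a)U$ for all $a\in A$. -/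

import Mathlib

open scoped TensorProduct

noncomputable section

namespace PartialQG

/-! ### Multiplier algebras of non-unital complex algebras -/

section Multipliers

variable (B : Type*) [NonUnitalRing B] [Module ℂ B] [IsScalarTower ℂ B B] [SMulCommClass ℂ B B]

/-- The multiplier algebra `M(B)`: couples `m = (λ, ρ)` in `End(B) ⊕ End(B)ᵒᵖ` such that, writing
`m b = λ(b)` and `a m = ρ(a)`, one has `a (m b) = (a m) b`. -/
def multiplierAlgebra : Subalgebra ℂ (Module.End ℂ B × (Module.End ℂ B)ᵐᵒᵖ) where
  carrier := {m | ∀ a b : B, a * m.1 b = m.2.unop a * b}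
  mul_mem' := by
    intro m n hm hn a b
    simp only [Set.mem_ofPred_eq] at hm hn
    simp [hm, hn]
  add_mem' := by
    intro m n hm hn a b
    simp only [Set.mem_ofPred_eq] at hm hn
    simp [hm, hn, mul_add, add_mul]
  algebraMap_mem' := by
    intro c a b
    simp [Algebra.algebraMap_eq_smul_one, mul_smul_comm, smul_mul_assoc]

/-- The type of multipliers of `B`. -/
abbrev Multiplier : Type _ := ↥(multiplierAlgebra B)

end Multipliers

namespace Multiplier

variable {B C : Type*}
  [NonUnitalRing B] [Module ℂ B] [IsScalarTower ℂ B B] [SMulCommClass ℂ B B]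
  [NonUnitalRing C] [Module ℂ C] [IsScalarTower ℂ C C] [SMulCommClass ℂ C C]

/-- Left multiplication `b ↦ m b` by a multiplier. -/
def left (m : Multiplier B) : B →ₗ[ℂ] B := m.1.1

/-- Right multiplication `b ↦ b m` by a multiplier. -/
def right (m : Multiplier B) : B →ₗ[ℂ] B := m.1.2.unop

theorem mul_left (m : Multiplier B) (a b : B) : a * m.left b = m.right a * b := m.2 a b

/-- The multiplier `(l, r)`. -/
def ofPair (l r : B →ₗ[ℂ] B) (h : ∀ a b : B, a * l b = r a * b) : Multiplier B :=
  ⟨(l, MulOpposite.op r), h⟩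

@[ext] theorem ext {m n : Multiplier B} (hl : ∀ b, m.left b = n.left b)
    (hr : ∀ b, m.right b = n.right b) : m = n := by
  apply Subtype.ext
  apply Prod.ext
  · exact LinearMap.ext hl
  · exact MulOpposite.unop_injective (LinearMap.ext hr)

/-- The canonical map `B → M(B)`. -/
def ofElem : B →ₗ[ℂ] Multiplier B where
  toFun x := ofPair (LinearMap.mulLeft ℂ x) (LinearMap.mulRight ℂ x)
    (fun a b => by simp [mul_assoc])
  map_add' x y := by
    ext b
    · exact add_mul x y b
    · exact mul_add b x y
  map_smul' c x := by
    ext b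
    · exact smul_mul_assoc c x b
    · exact mul_smul_comm c b x

/-- The multiplier `m ⊗ n` of `B ⊗ C`, as a bilinear map in `m ∈ M(B)` and `n ∈ M(C)`. -/
def tmul : Multiplier B →ₗ[ℂ] Multiplier C →ₗ[ℂ] Multiplier (B ⊗[ℂ] C) :=
  LinearMap.mk₂ ℂ
    (fun m n => ofPair (TensorProduct.map m.left n.left) (TensorProduct.map m.right n.right)
      (fun a b => by
        induction a with
        | zero => simp
        | add x y hx hy => simp only [add_mul, map_add, hx, hy]
        | tmul x y =>
          induction b with
          | zero => simp
          | add u v hu hv => simp only [mul_add, map_add, hu, hv]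
          | tmul u v => simp [mul_left]))
    (fun m₁ m₂ n => by
      ext b
      · exact LinearMap.congr_fun (TensorProduct.map_add_left m₁.left m₂.left n.left) b
      · exact LinearMap.congr_fun (TensorProduct.map_add_left m₁.right m₂.right n.right) b)
    (fun c m n => by
      ext b
      · exact LinearMap.congr_fun (TensorProduct.map_smul_left c m.left n.left) b
      · exact LinearMap.congr_fun (TensorProduct.map_smul_left c m.right n.right) b)
    (fun m n₁ n₂ => by
      ext b
      · exact LinearMap.congr_fun (TensorProduct.map_add_right m.left n₁.left n₂.left) b
      · exact LinearMap.congr_fun (TensorProduct.map_add_right m.right n₁.right n₂.right) b)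
    (fun c m n => by
      ext b
      · exact LinearMap.congr_fun (TensorProduct.map_smul_right c m.left n.left) b
      · exact LinearMap.congr_fun (TensorProduct.map_smul_right c m.right n.right) b)

/-- Transport of multipliers along an isomorphism of algebras. -/
def congr (e : B ≃ₗ[ℂ] C) (he : ∀ x y, e (x * y) = e x * e y) :
    Multiplier B →ₗ[ℂ] Multiplier C where
  toFun m := ofPair (e.toLinearMap ∘ₗ m.left ∘ₗ e.symm.toLinearMap)
    (e.toLinearMap ∘ₗ m.right ∘ₗ e.symm.toLinearMap) (fun a b => by
      have h := congrArg e (m.mul_left (e.symm a) (e.symm b))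
      simpa [he] using h)
  map_add' m n := by
    ext b
    · exact map_add e (m.left (e.symm b)) (n.left (e.symm b))
    · exact map_add e (m.right (e.symm b)) (n.right (e.symm b))
  map_smul' c m := by
    ext b
    · exact map_smul e c (m.left (e.symm b))
    · exact map_smul e c (m.right (e.symm b))

/-- `IsStar m n` says that `n` is the adjoint multiplier `m*`, which is given by
`m* x = (x* m)*` and `x m* = (m x*)*`. -/
def IsStar [Star B] (m n : Multiplier B) : Prop :=
  (∀ x, n.left x = star (m.right (star x))) ∧ ∀ x, n.right x = star (m.left (star x))

end Multiplier

section Flips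

variable (A : Type*) [NonUnitalRing A] [Module ℂ A] [IsScalarTower ℂ A A] [SMulCommClass ℂ A A]

theorem comm_mul (x y : A ⊗[ℂ] A) : TensorProduct.comm ℂ A A (x * y)
    = TensorProduct.comm ℂ A A x * TensorProduct.comm ℂ A A y := by
  induction x with
  | zero => simp
  | add x y hx hy => simp only [add_mul, map_add, hx, hy]
  | tmul a b =>
    induction y with
    | zero => simp
    | add u v hu hv => simp only [mul_add, map_add, hu, hv]
    | tmul u v => simp

theorem assoc_symm_mul (x y : A ⊗[ℂ] (A ⊗[ℂ] A)) : (TensorProduct.assoc ℂ A A A).symm (x * y)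
    = (TensorProduct.assoc ℂ A A A).symm x * (TensorProduct.assoc ℂ A A A).symm y := by
  induction x with
  | zero => simp
  | add x y hx hy => simp only [add_mul, map_add, hx, hy]
  | tmul a b =>
    induction y with
    | zero => simp
    | add u v hu hv => simp only [mul_add, map_add, hu, hv]
    | tmul u v =>
      induction b with
      | zero => simp
      | add x y hx hy =>
        simp only [Algebra.TensorProduct.tmul_mul_tmul, add_mul, TensorProduct.tmul_add,
          map_add] at hx hy ⊢
        rw [hx, hy]
      | tmul b c =>
        induction v with
        | zero => simp
        | add x y hx hy =>
          simp only [Algebra.TensorProduct.tmul_mul_tmul, mul_add, TensorProduct.tmul_add,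
            map_add] at hx hy ⊢
          rw [hx, hy]
        | tmul v w => simp

end Flips

/-! ### Partial algebras -/

/-- The span `V ⊗ W ⊆ B ⊗ C` of the tensors `v ⊗ w`. -/
def tensorSub {B C : Type*} [AddCommGroup B] [Module ℂ B] [AddCommGroup C] [Module ℂ C]
    (V : Submodule ℂ B) (W : Submodule ℂ C) : Submodule ℂ (B ⊗[ℂ] C) :=
  Submodule.map₂ (TensorProduct.mk ℂ B C) V W

section PartialAlgebras

variable (J A : Type*) [NonUnitalRing A] [Module ℂ A] [IsScalarTower ℂ A A] [SMulCommClass ℂ A A]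

open scoped Classical in
/-- The structure of a `J`-partial algebra on the algebra `A`: a decomposition of `A` as the direct
sum of subspaces `grade r s` for `r, s ∈ J`, such that `grade r s · grade s' t` is zero when
`s ≠ s'` and `grade r s · grade s t ⊆ grade r t`. -/
structure PartialAlgebra where
  /-- the homogeneous component with left index `r` and right index `s` -/
  grade : J → J → Submodule ℂ A
  isInternal : DirectSum.IsInternal (fun p : J × J => grade p.1 p.2)
  mul_eq_zero : ∀ {r s s' t : J} {a b : A}, a ∈ grade r s → b ∈ grade s' t → s ≠ s' → a * b = 0
  mul_mem : ∀ {r s t : J} {a b : A}, a ∈ grade r s → b ∈ grade s t → a * b ∈ grade r t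

variable {J A}

namespace PartialAlgebra

variable (P : PartialAlgebra J A)

/-- The elements with right index `s`, i.e. the sum of all `grade r s` over `r`. -/
def col (s : J) : Submodule ℂ A := ⨆ r, P.grade r s

/-- The elements with left index `r`, i.e. the sum of all `grade r s` over `s`. -/
def row (r : J) : Submodule ℂ A := ⨆ s, P.grade r s

/-- Non-degeneracy as a partial algebra: every algebra `col s` is left non-degenerate and every
algebra `row r` is right non-degenerate. -/
def IsNondegenerate : Prop :=
  (∀ s, ∀ a ∈ P.col s, (∀ b ∈ P.col s, a * b = 0) → a = 0) ∧
  (∀ r, ∀ a ∈ P.row r, (∀ b ∈ P.row r, b * a = 0) → a = 0)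

/-- Idempotency as a partial algebra: all the algebras `col s` and `row r` are spanned by the
products of their elements. -/
def IsIdempotent : Prop :=
  (∀ s, Submodule.map₂ (LinearMap.mul ℂ A) (P.col s) (P.col s) = P.col s) ∧
  (∀ r, Submodule.map₂ (LinearMap.mul ℂ A) (P.row r) (P.row r) = P.row r)

open scoped Classical in
/-- The decomposition of `A` as the direct sum of its components. -/
def decomposition : (DirectSum (J × J) fun p => P.grade p.1 p.2) ≃ₗ[ℂ] A :=
  LinearEquiv.ofBijective (DirectSum.coeLinearMap (fun p : J × J => P.grade p.1 p.2))
    (show Function.Bijective _ from P.isInternal)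

open scoped Classical in
theorem decomposition_lof (p : J × J) (x : P.grade p.1 p.2) :
    P.decomposition (DirectSum.lof ℂ (J × J) (fun p : J × J => P.grade p.1 p.2) p x) = x := by
  simp only [decomposition, LinearEquiv.ofBijective_apply]
  exact DirectSum.coeLinearMap_lof (fun p : J × J => P.grade p.1 p.2) p x

open scoped Classical in
/-- The linear map on `A` that restricts to `F (r, s)` on every component `grade r s`. -/
def gluing {W : Type*} [AddCommGroup W] [Module ℂ W] (F : J × J → A →ₗ[ℂ] W) : A →ₗ[ℂ] W :=
  DirectSum.toModule ℂ (J × J) W (fun p => F p ∘ₗ (P.grade p.1 p.2).subtype) ∘ₗ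
    P.decomposition.symm.toLinearMap

theorem gluing_apply {W : Type*} [AddCommGroup W] [Module ℂ W] (F : J × J → A →ₗ[ℂ] W)
    {r s : J} {a : A} (ha : a ∈ P.grade r s) : P.gluing F a = F (r, s) a := by
  classical
  have h := (LinearEquiv.symm_apply_eq _).2 (P.decomposition_lof (r, s) ⟨a, ha⟩).symm
  have h2 := DirectSum.toModule_lof ℂ (r, s) (⟨a, ha⟩ : P.grade (r, s).1 (r, s).2)
    (φ := fun p : J × J => F p ∘ₗ (P.grade p.1 p.2).subtype)
  refine Eq.trans ?_ h2
  rw [← h]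
  unfold gluing
  rw [LinearMap.comp_apply, LinearEquiv.coe_coe]

/-- Induction over the homogeneous elements. -/
theorem induction_grade {p : A → Prop} (h0 : p 0) (hadd : ∀ a b, p a → p b → p (a + b))
    (hg : ∀ r s, ∀ a ∈ P.grade r s, p a) (a : A) : p a := by
  classical
  have ha : a ∈ ⨆ q : J × J, P.grade q.1 q.2 := by
    rw [P.isInternal.submodule_iSup_eq_top]; trivial
  exact Submodule.iSup_induction (motive := p) _ ha (fun q a h => hg q.1 q.2 a h) h0 hadd

/-- The multiplier `∑ r, f r • 𝟏(r)` (a strictly convergent sum), where `𝟏(r)` is the base unit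
at `r`: an element `a` of `grade r s` satisfies `m a = f r • a` and `a m = f s • a`. -/
def diag (f : J → ℂ) : Multiplier A :=
  Multiplier.ofPair (P.gluing fun p => f p.1 • LinearMap.id) (P.gluing fun p => f p.2 • LinearMap.id)
    (fun a b => by
      induction a using P.induction_grade with
      | h0 => simp
      | hadd a a' h h' => simp only [add_mul, map_add, h, h']
      | hg r s a ha =>
        induction b using P.induction_grade with
        | h0 => simp
        | hadd b b' h h' => simp only [mul_add, map_add, h, h']
        | hg s' t b hb =>
          rw [P.gluing_apply _ ha, P.gluing_apply _ hb]
          by_cases hs : s = s'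
          · subst hs
            simp [mul_smul_comm, smul_mul_assoc]
          · simp [mul_smul_comm, smul_mul_assoc, P.mul_eq_zero ha hb hs])

theorem diag_left (f : J → ℂ) {r s : J} {a : A} (ha : a ∈ P.grade r s) :
    (P.diag f).left a = f r • a := P.gluing_apply _ ha

theorem diag_right (f : J → ℂ) {r s : J} {a : A} (ha : a ∈ P.grade r s) :
    (P.diag f).right a = f s • a := P.gluing_apply _ ha

end PartialAlgebra

end PartialAlgebras

/-! ### `I²`-partial algebras

An index in `I × I` is written as a column: `(r, t)` stands for `r` above `t`. Thus
`grade (r, t) (s, u)` is the component with upper left index `r`, lower left index `t`, upper right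
index `s` and lower right index `u`. -/

namespace PartialAlgebra

variable {I A : Type*} [NonUnitalRing A] [Module ℂ A] [IsScalarTower ℂ A A] [SMulCommClass ℂ A A]
variable (P : PartialAlgebra (I × I) A)

/-- The elements with upper left index `r`. -/
def upLeft (r : I) : Submodule ℂ A := ⨆ t, P.row (r, t)

/-- The elements with lower left index `t`. -/
def lowLeft (t : I) : Submodule ℂ A := ⨆ r, P.row (r, t)

/-- The elements with upper right index `s`. -/
def upRight (s : I) : Submodule ℂ A := ⨆ u, P.col (s, u)

/-- The elements with lower right index `u`. -/
def lowRight (u : I) : Submodule ℂ A := ⨆ s, P.col (s, u)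

open scoped Classical in
/-- The base unit `𝟏^r = ∑ t, 𝟏(r, t)`. -/
def upUnit (r : I) : Multiplier A := P.diag fun p => if p.1 = r then 1 else 0

open scoped Classical in
/-- The base unit `𝟏_t = ∑ r, 𝟏(r, t)`. -/
def lowUnit (t : I) : Multiplier A := P.diag fun p => if p.2 = t then 1 else 0

/-- The idempotent multiplier `E = ∑ t, 𝟏_t ⊗ 𝟏^t` of `A ⊗ A` (a strictly convergent sum): for `a`
with lower left index `t` one has `E (a ⊗ b) = a ⊗ 𝟏^t b`, and for `a` with lower right index `u`
one has `(a ⊗ b) E = a ⊗ b 𝟏^u`. -/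
def E : Multiplier (A ⊗[ℂ] A) :=
  Multiplier.ofPair
    (TensorProduct.lift (P.gluing fun p =>
      (LinearMap.lcomp ℂ (A ⊗[ℂ] A) (P.upUnit p.1.2).left) ∘ₗ TensorProduct.mk ℂ A A))
    (TensorProduct.lift (P.gluing fun p =>
      (LinearMap.lcomp ℂ (A ⊗[ℂ] A) (P.upUnit p.2.2).right) ∘ₗ TensorProduct.mk ℂ A A))
    (fun x y => by
      induction x with
      | zero => simp
      | add x x' h h' => simp only [add_mul, map_add, h, h']
      | tmul a b =>
        induction y with
        | zero => simp
        | add y y' h h' => simp only [mul_add, map_add, h, h']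
        | tmul c d =>
          simp only [TensorProduct.lift.tmul]
          induction a using P.induction_grade with
          | h0 => simp
          | hadd a a' h h' =>
            simp only [TensorProduct.add_tmul, add_mul, map_add, LinearMap.add_apply, h, h']
          | hg r s a ha =>
            induction c using P.induction_grade with
            | h0 => simp
            | hadd c c' h h' =>
              simp only [TensorProduct.add_tmul, mul_add, map_add, LinearMap.add_apply, h, h']
            | hg s' t c hc =>
              rw [P.gluing_apply _ ha, P.gluing_apply _ hc]
              by_cases hs : s = s'
              · subst hs
                simp [Multiplier.mul_left]
              · simp [P.mul_eq_zero ha hc hs])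

/-- The component of `A ⊗^I A` with left index `p` and right index `q`. -/
def tensorGrade (p q : I × I) : Submodule ℂ (A ⊗[ℂ] A) :=
  ⨆ t : I, ⨆ u : I, tensorSub (P.grade (p.1, t) (q.1, u)) (P.grade (t, p.2) (u, q.2))

/-- The elements of `A ⊗^I A` with right index `q`. -/
def tensorCol (q : I × I) : Submodule ℂ (A ⊗[ℂ] A) := ⨆ p, P.tensorGrade p q

/-- The elements of `A ⊗^I A` with left index `p`. -/
def tensorRow (p : I × I) : Submodule ℂ (A ⊗[ℂ] A) := ⨆ q, P.tensorGrade p q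

/-- The restricted multiplier algebra of `A ⊗^I A`. Multipliers of `A ⊗^I A` are
regarded as elements of `E M(A ⊗ A) E`, and it is required that `x (a ⊗ 1)`, `x (1 ⊗ a)`,
`(a ⊗ 1) x` and `(1 ⊗ a) x` are in `A ⊗ A` for all `a ∈ A`. -/
def IsRestricted (x : Multiplier (A ⊗[ℂ] A)) : Prop :=
  P.E * x = x ∧ x * P.E = x ∧ ∀ a : A,
    x * Multiplier.tmul (Multiplier.ofElem a) 1 ∈ LinearMap.range Multiplier.ofElem ∧
    x * Multiplier.tmul 1 (Multiplier.ofElem a) ∈ LinearMap.range Multiplier.ofElem ∧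
    Multiplier.tmul (Multiplier.ofElem a) 1 * x ∈ LinearMap.range Multiplier.ofElem ∧
    Multiplier.tmul 1 (Multiplier.ofElem a) * x ∈ LinearMap.range Multiplier.ofElem

end PartialAlgebra

section Slices

variable {A : Type*} [NonUnitalRing A] [Module ℂ A] [IsScalarTower ℂ A A] [SMulCommClass ℂ A A]

/-- `(id ⊗ ω)(z)` for `z ∈ A ⊗ A`. -/
def sliceSnd (ω : A →ₗ[ℂ] ℂ) : A ⊗[ℂ] A →ₗ[ℂ] A :=
  (TensorProduct.rid ℂ A).toLinearMap ∘ₗ TensorProduct.map LinearMap.id ω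

/-- `(ω ⊗ id)(z)` for `z ∈ A ⊗ A`. -/
def sliceFst (ω : A →ₗ[ℂ] ℂ) : A ⊗[ℂ] A →ₗ[ℂ] A :=
  (TensorProduct.lid ℂ A).toLinearMap ∘ₗ TensorProduct.map ω LinearMap.id

/-- `m = (id ⊗ ω)(x)` for a restricted multiplier `x`, i.e. `m a = (id ⊗ ω)(x (a ⊗ 1))` and
`a m = (id ⊗ ω)((a ⊗ 1) x)` for all `a ∈ A`. -/
def IsSliceSnd (ω : A →ₗ[ℂ] ℂ) (x : Multiplier (A ⊗[ℂ] A)) (m : Multiplier A) : Prop :=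
  ∀ a : A,
    (∃ z, Multiplier.ofElem z = x * Multiplier.tmul (Multiplier.ofElem a) 1 ∧
      m.left a = sliceSnd ω z) ∧
    (∃ z, Multiplier.ofElem z = Multiplier.tmul (Multiplier.ofElem a) 1 * x ∧
      m.right a = sliceSnd ω z)

/-- `m = (ω ⊗ id)(x)` for a restricted multiplier `x`, i.e. `m a = (ω ⊗ id)(x (1 ⊗ a))` and
`a m = (ω ⊗ id)((1 ⊗ a) x)` for all `a ∈ A`. -/
def IsSliceFst (ω : A →ₗ[ℂ] ℂ) (x : Multiplier (A ⊗[ℂ] A)) (m : Multiplier A) : Prop :=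
  ∀ a : A,
    (∃ z, Multiplier.ofElem z = x * Multiplier.tmul 1 (Multiplier.ofElem a) ∧
      m.left a = sliceFst ω z) ∧
    (∃ z, Multiplier.ofElem z = Multiplier.tmul 1 (Multiplier.ofElem a) * x ∧
      m.right a = sliceFst ω z)

end Slices

/-! ### Comultiplications -/

section Comultiplications

variable {A : Type*} [NonUnitalRing A] [Module ℂ A] [IsScalarTower ℂ A A] [SMulCommClass ℂ A A]

/-- `Δ ⊗ id : A ⊗ A → M(A ⊗ A ⊗ A)`. -/
def comulId (Δ : A →ₙₐ[ℂ] Multiplier (A ⊗[ℂ] A)) :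
    A ⊗[ℂ] A →ₗ[ℂ] Multiplier ((A ⊗[ℂ] A) ⊗[ℂ] A) :=
  TensorProduct.lift (Multiplier.tmul.compl₁₂ (Δ : A →ₗ[ℂ] Multiplier (A ⊗[ℂ] A))
    Multiplier.ofElem)

/-- `id ⊗ Δ : A ⊗ A → M(A ⊗ A ⊗ A)`. -/
def idComul (Δ : A →ₙₐ[ℂ] Multiplier (A ⊗[ℂ] A)) :
    A ⊗[ℂ] A →ₗ[ℂ] Multiplier ((A ⊗[ℂ] A) ⊗[ℂ] A) :=
  Multiplier.congr (TensorProduct.assoc ℂ A A A).symm (assoc_symm_mul A) ∘ₗ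
    TensorProduct.lift (Multiplier.tmul.compl₁₂ Multiplier.ofElem
      (Δ : A →ₗ[ℂ] Multiplier (A ⊗[ℂ] A)))

/-- `IsExtensionValue f e m X` says that `X` is the value at `m ∈ M(B)` of the extension of the
homomorphism `f : B → M(C)` to `M(B)` with unit `e`: `X = e X = X e`, and `X f(z) = f(m z)` and
`f(z) X = f(z m)` for all `z ∈ B`. -/
def IsExtensionValue {B C : Type*}
    [NonUnitalRing B] [Module ℂ B] [IsScalarTower ℂ B B] [SMulCommClass ℂ B B]
    [NonUnitalRing C] [Module ℂ C] [IsScalarTower ℂ C C] [SMulCommClass ℂ C C]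
    (f : B →ₗ[ℂ] Multiplier C) (e : Multiplier C) (m : Multiplier B) (X : Multiplier C) : Prop :=
  e * X = X ∧ X * e = X ∧ ∀ z : B, X * f z = f (m.left z) ∧ f z * X = f (m.right z)

/-- The opposite `Δᵒᵖ(a)` of the comultiplication. -/
def comulOp (Δ : A →ₙₐ[ℂ] Multiplier (A ⊗[ℂ] A)) : A →ₗ[ℂ] Multiplier (A ⊗[ℂ] A) :=
  Multiplier.congr (TensorProduct.comm ℂ A A) (comm_mul A) ∘ₗ
    (Δ : A →ₗ[ℂ] Multiplier (A ⊗[ℂ] A))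

/-- The map `a ⊗ b ↦ Δ(a) (1 ⊗ b)` with values in `M(A ⊗ A)`. -/
def canRight (Δ : A →ₗ[ℂ] Multiplier (A ⊗[ℂ] A)) : A ⊗[ℂ] A →ₗ[ℂ] Multiplier (A ⊗[ℂ] A) :=
  TensorProduct.lift ((LinearMap.mul ℂ (Multiplier (A ⊗[ℂ] A))).compl₁₂ Δ
    (Multiplier.tmul 1 ∘ₗ Multiplier.ofElem))

/-- The map `a ⊗ b ↦ (a ⊗ 1) Δ(b)` with values in `M(A ⊗ A)`. -/
def canLeft (Δ : A →ₗ[ℂ] Multiplier (A ⊗[ℂ] A)) : A ⊗[ℂ] A →ₗ[ℂ] Multiplier (A ⊗[ℂ] A) :=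
  TensorProduct.lift ((LinearMap.mul ℂ (Multiplier (A ⊗[ℂ] A))).compl₁₂
    (Multiplier.tmul.flip 1 ∘ₗ Multiplier.ofElem) Δ)

/-- The map `f`, with values in `M(A ⊗ A)`, restricts to a bijection from the subspace `V` of
`A ⊗ A` onto the subspace `W` of `A ⊗ A ⊆ M(A ⊗ A)`. -/
def IsBijectiveBetween (f : A ⊗[ℂ] A →ₗ[ℂ] Multiplier (A ⊗[ℂ] A))
    (V W : Submodule ℂ (A ⊗[ℂ] A)) : Prop :=
  Set.BijOn f V (W.map Multiplier.ofElem)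

end Comultiplications

/-! ### Regular partial multiplier bialgebras and Hopf algebras -/

section Hopf

variable (I A : Type*) [NonUnitalRing A] [Module ℂ A] [IsScalarTower ℂ A A] [SMulCommClass ℂ A A]

/-- A regular `I`-partial multiplier bialgebra with total algebra `A`. -/
structure RegularPartialMultiplierBialgebra extends PartialAlgebra (I × I) A where
  nondegenerate : toPartialAlgebra.IsNondegenerate
  idempotent : toPartialAlgebra.IsIdempotent
  /-- the comultiplication -/
  comul : A →ₙₐ[ℂ] Multiplier (A ⊗[ℂ] A)
  /-- `Δ(A)` is contained in the restricted multiplier algebra of `A ⊗^I A` -/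
  comul_restricted : ∀ a, toPartialAlgebra.IsRestricted (comul a)
  /-- `(A ⊗^I A)_q · Δ(A_q) = (A ⊗^I A)_q` -/
  comul_col : ∀ q : I × I,
    Submodule.span ℂ {y | ∃ x ∈ toPartialAlgebra.tensorCol q, ∃ a ∈ toPartialAlgebra.col q,
      y = (comul a).right x} = toPartialAlgebra.tensorCol q
  /-- `Δ(_p A) · _p(A ⊗^I A) = _p(A ⊗^I A)` -/
  comul_row : ∀ p : I × I,
    Submodule.span ℂ {y | ∃ x ∈ toPartialAlgebra.tensorRow p, ∃ a ∈ toPartialAlgebra.row p,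
      y = (comul a).left x} = toPartialAlgebra.tensorRow p
  /-- coassociativity: `(Δ ⊗ id)(Δ(a))` and `(id ⊗ Δ)(Δ(a))` are the same multiplier; the extensions
  of `Δ ⊗ id` and `id ⊗ Δ` to multipliers have the units `E ⊗ 1` and `1 ⊗ E` -/
  coassoc : ∀ a, ∃ X : Multiplier ((A ⊗[ℂ] A) ⊗[ℂ] A),
    IsExtensionValue (comulId comul) (Multiplier.tmul toPartialAlgebra.E 1) (comul a) X ∧
    IsExtensionValue (idComul comul)
      (Multiplier.congr (TensorProduct.assoc ℂ A A A).symm (assoc_symm_mul A)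
        (Multiplier.tmul 1 toPartialAlgebra.E)) (comul a) X
  /-- the counit -/
  counit : A →ₗ[ℂ] ℂ
  counit_eq_zero : ∀ r s t u : I, r ≠ t ∨ s ≠ u → ∀ a ∈ grade (r, t) (s, u), counit a = 0
  counit_ne_zero : ∀ r : I, (∃ a ∈ toPartialAlgebra.lowRight r, counit a ≠ 0) ∧
    ∃ a ∈ toPartialAlgebra.lowLeft r, counit a ≠ 0
  counit_mul : ∀ s t : I, ∀ a ∈ toPartialAlgebra.col (s, t), ∀ b ∈ toPartialAlgebra.row (s, t),
    counit (a * b) = counit a * counit b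
  id_counit_comul : ∀ a, IsSliceSnd counit (comul a) (Multiplier.ofElem a)
  counit_id_comul : ∀ a, IsSliceFst counit (comul a) (Multiplier.ofElem a)

/-- A regular `I`-partial multiplier Hopf algebra with total algebra `A`: a regular `I`-partial
multiplier bialgebra for which the four canonical maps are bijective. -/
structure RegularPartialMultiplierHopfAlgebra extends RegularPartialMultiplierBialgebra I A where
  can_r : IsBijectiveBetween (canRight (comul : A →ₗ[ℂ] Multiplier (A ⊗[ℂ] A)))
    (⨆ r, tensorSub (toPartialAlgebra.lowRight r) (toPartialAlgebra.lowLeft r))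
    (⨆ r, tensorSub (toPartialAlgebra.lowLeft r) (toPartialAlgebra.upLeft r))
  can_l : IsBijectiveBetween (canLeft (comul : A →ₗ[ℂ] Multiplier (A ⊗[ℂ] A)))
    (⨆ r, tensorSub (toPartialAlgebra.upRight r) (toPartialAlgebra.upLeft r))
    (⨆ r, tensorSub (toPartialAlgebra.lowRight r) (toPartialAlgebra.upRight r))
  can_rc : IsBijectiveBetween (canRight (comulOp comul))
    (⨆ r, tensorSub (toPartialAlgebra.upRight r) (toPartialAlgebra.upLeft r))
    (⨆ r, tensorSub (toPartialAlgebra.upLeft r) (toPartialAlgebra.lowLeft r))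
  can_lc : IsBijectiveBetween (canLeft (comulOp comul))
    (⨆ r, tensorSub (toPartialAlgebra.lowRight r) (toPartialAlgebra.lowLeft r))
    (⨆ r, tensorSub (toPartialAlgebra.upRight r) (toPartialAlgebra.lowRight r))

variable {I A}

/-- A functional `φ` is left invariant if it is supported on the components with equal left and
right index and `(id ⊗ φ)Δ(a) = ∑ r, φ(𝟏^r a) 𝟏^r = ∑ r, φ(a 𝟏^r) 𝟏^r` in `M(A)`. -/
def RegularPartialMultiplierBialgebra.IsLeftInvariant
    (Q : RegularPartialMultiplierBialgebra I A) (φ : A →ₗ[ℂ] ℂ) : Prop :=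
  (∀ p q : I × I, p ≠ q → ∀ a ∈ Q.grade p q, φ a = 0) ∧
  ∀ a, IsSliceSnd φ (Q.comul a) (Q.diag fun p => φ ((Q.upUnit p.1).left a)) ∧
    IsSliceSnd φ (Q.comul a) (Q.diag fun p => φ ((Q.upUnit p.1).right a))

/-- A functional is faithful if its left and right kernels are zero. -/
def IsFaithful (φ : A →ₗ[ℂ] ℂ) : Prop :=
  (∀ a, (∀ b, φ (a * b) = 0) → a = 0) ∧ ∀ a, (∀ b, φ (b * a) = 0) → a = 0

end Hopf

/-! ### Partial `*`-algebraic quantum groups -/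

section StarHopf

variable (I A : Type*) [NonUnitalRing A] [Module ℂ A] [IsScalarTower ℂ A A] [SMulCommClass ℂ A A]
  [StarRing A] [StarModule ℂ A]

/-- An `I`-partial multiplier Hopf `*`-algebra with total `*`-algebra `A`. -/
structure PartialMultiplierHopfStarAlgebra extends RegularPartialMultiplierHopfAlgebra I A where
  star_mem : ∀ {p q : I × I} {a : A}, a ∈ grade p q → star a ∈ grade q p
  comul_star : ∀ a, (comul a).IsStar (comul (star a))

/-- An `I`-partial `*`-algebraic quantum group with total `*`-algebra `A`: an `I`-partial
multiplier Hopf `*`-algebra that possesses a positive faithful left invariant functional. -/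
structure PartialStarAlgebraicQuantumGroup extends PartialMultiplierHopfStarAlgebra I A where
  exists_integral : ∃ φ : A →ₗ[ℂ] ℂ,
    toRegularPartialMultiplierBialgebra.IsLeftInvariant φ ∧ IsFaithful φ ∧
    ∀ a, 0 ≤ (φ (star a * a)).re ∧ (φ (star a * a)).im = 0

end StarHopf

/-! ### Unitary modules and `*`-representations -/

section Representations

variable (A : Type*) [NonUnitalRing A] [Module ℂ A] [IsScalarTower ℂ A A] [SMulCommClass ℂ A A]
  [StarRing A] [StarModule ℂ A]

/-- A (left) unitary module on the pre-Hilbert space `V`: an `A`-module structure with `A V = V`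
such that `⟨v, a w⟩ = ⟨a* v, w⟩`. -/
structure UnitaryModule (V : Type*) [NormedAddCommGroup V] [InnerProductSpace ℂ V] where
  /-- the action of `A` by linear maps -/
  act : A →ₙₐ[ℂ] Module.End ℂ V
  unital : Submodule.span ℂ {x : V | ∃ a v, x = act a v} = ⊤
  inner_act : ∀ (a : A) (v w : V), inner ℂ v (act a w) = inner ℂ (act (star a) v) w

/-- A (left, bounded) `*`-representation on the Hilbert space `H`: a `*`-homomorphism
`A → B(H)` such that `A H` is dense in `H`. -/
structure StarRepresentation (H : Type*) [NormedAddCommGroup H] [InnerProductSpace ℂ H]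
    [CompleteSpace H] where
  /-- the `*`-homomorphism into the bounded operators -/
  hom : A →⋆ₙₐ[ℂ] (H →L[ℂ] H)
  dense : Dense (Submodule.span ℂ {x : H | ∃ a ξ, x = hom a ξ} : Set H)

variable {A}

/-- The `*`-representation `R` on `H` is a completion of the unitary module `M` on `V` by means of
the isometry `j : V → H`: `j` has dense range and intertwines the actions of `A`. -/
def UnitaryModule.IsCompletion {V : Type*} [NormedAddCommGroup V] [InnerProductSpace ℂ V]
    (M : UnitaryModule A V) {H : Type*} [NormedAddCommGroup H] [InnerProductSpace ℂ H]
    [CompleteSpace H] (R : StarRepresentation A H) (j : V →ₗᵢ[ℂ] H) : Prop :=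
  DenseRange j ∧ ∀ (a : A) (v : V), R.hom a (j v) = j (M.act a v)

end Representations

end PartialQG

end

-- Let `φ` be a positive faithful left invariant functional and `Λ : A → H` the identification of
-- `A` with the pre-Hilbert space given by `⟨Λ a, Λ b⟩ = φ(a* b)`. Write `v ∈ V = AV` as `∑ aᵢ wᵢ`.
-- For `c` homogeneous with upper right index `r`, let `Δ(c)(v ⊗ 1)` stand for `∑ Δ(c)(aᵢ ⊗ 1)`
-- applied to `wᵢ` in the first leg and to `Λ` in the second, a vector of `V ⊗ H`. Left invariance
-- turns its squared norm into `φ(c* c) ‖𝟏^r v‖²`, so it is at most `‖Λ c‖ ‖v‖` long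
-- (`norm_sum_actTensor_le`).
--
-- Pairing its second leg with `Λ(b*)` gives `T v` for `T = (id ⊗ φ)((1 ⊗ b)Δ(c))`, hence `‖T v‖ ≤
-- ‖Λ(b*)‖ ‖Λ c‖ ‖v‖` (`norm_act_sliceSnd_le`).
--
-- Such `T` span enough: by surjectivity of `(b ⊗ 1)Δᵒᵖ(c)`, every `y ⊗ x` with the upper right
-- index of `y` equal to the lower right index of `x` is a sum of such elements, so `φ(y) x` is
-- bounded. The counit and faithfulness provide a `y` with `φ(y) ≠ 0`. Bounded operators extend to
-- the completion, and density gives both uniqueness claims.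

universe u

set_option linter.unusedSectionVars false

namespace PartialQG

open TensorProduct

noncomputable section

/-! ### Slice maps and multiplier identities tested by right multiplication -/

section Slices

variable {A : Type*} [NonUnitalRing A] [Module ℂ A] [IsScalarTower ℂ A A] [SMulCommClass ℂ A A]

@[simp] theorem sliceSnd_tmul (ω : A →ₗ[ℂ] ℂ) (a b : A) :
    sliceSnd ω (a ⊗ₜ b) = ω b • a := by
  simp [sliceSnd]

@[simp] theorem sliceFst_tmul (ω : A →ₗ[ℂ] ℂ) (a b : A) :
    sliceFst ω (a ⊗ₜ b) = ω a • b := by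
  simp [sliceFst]

theorem sliceFst_comm (ω : A →ₗ[ℂ] ℂ) (z : A ⊗[ℂ] A) :
    sliceFst ω (TensorProduct.comm ℂ A A z) = sliceSnd ω z := by
  induction z with
  | zero => simp
  | add x y hx hy => simp only [map_add, hx, hy]
  | tmul a b => simp

theorem sliceSnd_map_mulLeft (ω : A →ₗ[ℂ] ℂ) (a : A) (z : A ⊗[ℂ] A) :
    sliceSnd ω (TensorProduct.map (LinearMap.mulLeft ℂ a) LinearMap.id z) = a * sliceSnd ω z := by
  induction z with
  | zero => simp
  | add x y hx hy => simp only [map_add, mul_add, hx, hy]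
  | tmul b c => simp [mul_smul_comm]

theorem sliceSnd_map_mulRight (ω : A →ₗ[ℂ] ℂ) (a : A) (z : A ⊗[ℂ] A) :
    sliceSnd ω (TensorProduct.map (LinearMap.mulRight ℂ a) LinearMap.id z) = sliceSnd ω z * a := by
  induction z with
  | zero => simp
  | add x y hx hy => simp only [map_add, add_mul, hx, hy]
  | tmul b c => simp [smul_mul_assoc]

/-- Associativity `y ((a ⊗ 1) z) = (y (a ⊗ 1)) z`, with `a ⊗ 1` present only as a multiplier, `A`
having no unit. -/
theorem mul_map_mulLeft_fst (a : A) (y z : A ⊗[ℂ] A) :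
    y * TensorProduct.map (LinearMap.mulLeft ℂ a) LinearMap.id z =
      TensorProduct.map (LinearMap.mulRight ℂ a) LinearMap.id y * z := by
  induction y with
  | zero => simp
  | add x y hx hy => simp only [map_add, add_mul, hx, hy]
  | tmul b c =>
    induction z with
    | zero => simp
    | add x y hx hy => simp only [map_add, mul_add, hx, hy]
    | tmul d e => simp [mul_assoc]

theorem mul_map_mulLeft_snd (a : A) (y z : A ⊗[ℂ] A) :
    y * TensorProduct.map LinearMap.id (LinearMap.mulLeft ℂ a) z =
      TensorProduct.map LinearMap.id (LinearMap.mulRight ℂ a) y * z := by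
  induction y with
  | zero => simp
  | add x y hx hy => simp only [map_add, add_mul, hx, hy]
  | tmul b c =>
    induction z with
    | zero => simp
    | add x y hx hy => simp only [map_add, mul_add, hx, hy]
    | tmul d e => simp [mul_assoc]

theorem mul_map_mulRight_fst (a : A) (y z : A ⊗[ℂ] A) :
    y * TensorProduct.map (LinearMap.mulRight ℂ a) LinearMap.id z =
      TensorProduct.map (LinearMap.mulRight ℂ a) LinearMap.id (y * z) := by
  induction y with
  | zero => simp
  | add x y hx hy => simp only [map_add, add_mul, hx, hy]
  | tmul b c =>
    induction z with
    | zero => simp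
    | add x y hx hy => simp only [map_add, mul_add, hx, hy]
    | tmul d e => simp [mul_assoc]

/-- The identity `z = x (a ⊗ 1)` in terms of right multiplication. -/
theorem mul_eq_of_ofElem_eq_mul_tmul_one {x : Multiplier (A ⊗[ℂ] A)} {z : A ⊗[ℂ] A} {a : A}
    (h : Multiplier.ofElem z = x * Multiplier.tmul (Multiplier.ofElem a) 1) (y : A ⊗[ℂ] A) :
    y * z = TensorProduct.map (LinearMap.mulRight ℂ a) LinearMap.id (x.right y) :=
  congrArg (fun m : Multiplier (A ⊗[ℂ] A) => m.right y) h

/-- The identity `z = (1 ⊗ b) x` in terms of right multiplication. -/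
theorem mul_eq_of_ofElem_eq_one_tmul_mul {x : Multiplier (A ⊗[ℂ] A)} {z : A ⊗[ℂ] A} {b : A}
    (h : Multiplier.ofElem z = Multiplier.tmul 1 (Multiplier.ofElem b) * x) (y : A ⊗[ℂ] A) :
    y * z = x.right (TensorProduct.map LinearMap.id (LinearMap.mulRight ℂ b) y) :=
  congrArg (fun m : Multiplier (A ⊗[ℂ] A) => m.right y) h

/-- The identity `z = x (a ⊗ 1)` in terms of left multiplication. -/
theorem mul_eq_of_ofElem_eq_mul_tmul_one' {x : Multiplier (A ⊗[ℂ] A)} {z : A ⊗[ℂ] A} {a : A}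
    (h : Multiplier.ofElem z = x * Multiplier.tmul (Multiplier.ofElem a) 1) (y : A ⊗[ℂ] A) :
    z * y = x.left (TensorProduct.map (LinearMap.mulLeft ℂ a) LinearMap.id y) :=
  congrArg (fun m : Multiplier (A ⊗[ℂ] A) => m.left y) h

variable [StarRing A] [StarModule ℂ A]

theorem star_mul_tensor (x y : A ⊗[ℂ] A) : star (x * y) = star y * star x := by
  induction x with
  | zero => simp
  | add u v hu hv => simp only [add_mul, mul_add, star_add, hu, hv]
  | tmul a b =>
    induction y with
    | zero => simp
    | add u v hu hv => simp only [add_mul, mul_add, star_add, hu, hv]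
    | tmul c d => simp

theorem star_map_mulLeft (a : A) (z : A ⊗[ℂ] A) :
    star (TensorProduct.map (LinearMap.mulLeft ℂ a) LinearMap.id z) =
      TensorProduct.map (LinearMap.mulRight ℂ (star a)) LinearMap.id (star z) := by
  induction z with
  | zero => simp
  | add x y hx hy => simp only [map_add, star_add, hx, hy]
  | tmul b c => simp

end Slices

/-! ### The pre-Hilbert space of the invariant functional -/

section GNS

variable {A : Type*} [NonUnitalRing A] [Module ℂ A] [IsScalarTower ℂ A A] [SMulCommClass ℂ A A]
  [StarRing A] [StarModule ℂ A]

/-- A functional with `φ(a* a) ≥ 0` is hermitian on products. -/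
theorem conj_apply_star_mul {φ : A →ₗ[ℂ] ℂ} (hφ : ∀ a, (φ (star a * a)).im = 0) (a b : A) :
    (starRingEnd ℂ) (φ (star b * a)) = φ (star a * b) := by
  -- Polarization: reality of `φ` at `a + b` gives the imaginary parts, at `a + i b` the real parts.
  have h1 := hφ (a + b)
  have h2 := hφ (a + Complex.I • b)
  simp only [star_add, star_smul, add_mul, mul_add, map_add, smul_mul_assoc, mul_smul_comm,
    map_smul, smul_eq_mul, Complex.add_im, hφ a, hφ b, Complex.mul_im, Complex.mul_re,
    RCLike.star_def, Complex.conj_I, Complex.neg_re, Complex.neg_im, Complex.I_re,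
    Complex.I_im] at h1 h2
  apply Complex.ext
  · simp only [Complex.conj_re]; linarith
  · simp only [Complex.conj_im]; linarith

/-- The semi-inner product `⟨a, b⟩ = φ(a* b)` of a positive functional `φ`. -/
abbrev gnsPreCore (φ : A →ₗ[ℂ] ℂ)
    (hφ : ∀ a, 0 ≤ (φ (star a * a)).re ∧ (φ (star a * a)).im = 0) :
    PreInnerProductSpace.Core ℂ A where
  inner a b := φ (star a * b)
  conj_inner_symm a b := conj_apply_star_mul (fun a => (hφ a).2) a b
  re_inner_nonneg a := (hφ a).1
  add_left a b c := by simp [add_mul]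
  smul_left a b c := by simp [smul_mul_assoc]

/-- By Cauchy–Schwarz `φ(b a)` vanishes for all `b`, and faithfulness applies. This makes the
semi-inner product definite. -/
theorem eq_zero_of_apply_star_mul_self {φ : A →ₗ[ℂ] ℂ} (hf : IsFaithful φ)
    (hφ : ∀ a, 0 ≤ (φ (star a * a)).re ∧ (φ (star a * a)).im = 0) {a : A}
    (ha : φ (star a * a) = 0) : a = 0 := by
  refine hf.2 a fun b => ?_
  have h := @InnerProductSpace.Core.inner_mul_inner_self_le ℂ A _ _ _ (gnsPreCore φ hφ) (star b) a
  change ‖φ (star (star b) * a)‖ * ‖φ (star a * star b)‖ ≤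
    (φ (star (star b) * star b)).re * (φ (star a * a)).re at h
  rw [ha, ← conj_apply_star_mul (fun a => (hφ a).2) a (star b), star_star, RCLike.norm_conj] at h
  simp only [Complex.zero_re, mul_zero] at h
  exact norm_eq_zero.1 (mul_self_eq_zero.1 (le_antisymm h (mul_self_nonneg _)))

/-- The pre-Hilbert space of a positive faithful functional. -/
theorem exists_gns {A : Type u} [NonUnitalRing A] [Module ℂ A] [IsScalarTower ℂ A A]
    [SMulCommClass ℂ A A] [StarRing A] [StarModule ℂ A] {φ : A →ₗ[ℂ] ℂ} (hf : IsFaithful φ)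
    (hφ : ∀ a, 0 ≤ (φ (star a * a)).re ∧ (φ (star a * a)).im = 0) :
    ∃ (H : Type u) (_ : NormedAddCommGroup H) (_ : InnerProductSpace ℂ H) (Λ : A ≃ₗ[ℂ] H),
      ∀ a b, inner ℂ (Λ a) (Λ b) = φ (star a * b) := by
  let c : InnerProductSpace.Core ℂ A :=
    { gnsPreCore φ hφ with definite := fun a h => eq_zero_of_apply_star_mul_self hf hφ h }
  -- The space is `A` itself, hidden behind an existential so that its norm and inner product stay
  -- apart from the algebra `A`.
  exact ⟨A, c.toNormedAddCommGroup, @InnerProductSpace.ofCore ℂ A _ _ _ c.toCore,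
    LinearEquiv.refl ℂ A, fun a b => rfl⟩

variable {H : Type*} [NormedAddCommGroup H] [InnerProductSpace ℂ H]
  {φ : A →ₗ[ℂ] ℂ} {Λ : A ≃ₗ[ℂ] H}

/-- Identifies `(φ ⊗ φ)(x* y)` with the inner product of `H ⊗ H`, so that `φ ⊗ φ` inherits
definiteness. -/
theorem inner_map_map_gns (hΛ : ∀ a b, inner ℂ (Λ a) (Λ b) = φ (star a * b)) (x y : A ⊗[ℂ] A) :
    inner ℂ (TensorProduct.map Λ.toLinearMap Λ.toLinearMap x)
      (TensorProduct.map Λ.toLinearMap Λ.toLinearMap y) =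
      φ (sliceSnd φ (star x * y)) := by
  induction x with
  | zero => simp
  | add u v hu hv => simp only [add_mul, star_add, map_add, inner_add_left, hu, hv]
  | tmul a b =>
    induction y with
    | zero => simp
    | add u v hu hv => simp only [mul_add, map_add, inner_add_right, hu, hv]
    | tmul c d => simp [hΛ, mul_comm]

/-- `A ⊗ A` is non-degenerate. -/
theorem tensor_ext_of_mul_left (hΛ : ∀ a b, inner ℂ (Λ a) (Λ b) = φ (star a * b))
    {z z' : A ⊗[ℂ] A} (h : ∀ y, y * z = y * z') : z = z' := by
  rw [← sub_eq_zero]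
  -- Testing with `y = (z - z')*` is enough: the image of `z - z'` in `H ⊗ H` then has norm zero.
  have h0 : star (z - z') * (z - z') = 0 := by rw [mul_sub, h, sub_self]
  have h1 := inner_map_map_gns hΛ (z - z') (z - z')
  rw [h0, map_zero, map_zero] at h1
  exact (map_eq_zero_iff _ (TensorProduct.congr Λ Λ).injective).1
    ((inner_self_eq_zero (𝕜 := ℂ)).1 h1)

end GNS

/-! ### Upper base units as self-adjoint projections -/

section Grading

variable {I A : Type*} [NonUnitalRing A] [Module ℂ A] [IsScalarTower ℂ A A] [SMulCommClass ℂ A A]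

theorem PartialAlgebra.upUnit_left_idem (P : PartialAlgebra (I × I) A) (r : I) (a : A) :
    (P.upUnit r).left ((P.upUnit r).left a) = (P.upUnit r).left a := by
  classical
  induction a using P.induction_grade with
  | h0 => simp
  | hadd a b ha hb => simp only [map_add, ha, hb]
  | hg p q a ha =>
    simp only [PartialAlgebra.upUnit, P.diag_left _ ha, map_smul, smul_smul]
    split_ifs <;> simp

theorem PartialAlgebra.upUnit_left_apply (P : PartialAlgebra (I × I) A) (r : I) {p q : I × I}
    {a : A} (ha : a ∈ P.grade p q) [Decidable (p.1 = r)] :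
    (P.upUnit r).left a = if p.1 = r then a else 0 := by
  rw [PartialAlgebra.upUnit, P.diag_left _ ha]
  split_ifs <;> simp

theorem PartialAlgebra.star_upUnit_left_mul [StarRing A] [StarModule ℂ A]
    (P : PartialAlgebra (I × I) A)
    (hP : ∀ {p q : I × I} {a : A}, a ∈ P.grade p q → star a ∈ P.grade q p) (r : I) (a b : A) :
    star ((P.upUnit r).left a) * b = star a * (P.upUnit r).left b := by
  classical
  induction a using P.induction_grade with
  | h0 => simp
  | hadd a b ha hb => simp only [map_add, star_add, add_mul, ha, hb]
  | hg p q a ha =>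
    induction b using P.induction_grade with
    | h0 => simp
    | hadd a b ha hb => simp only [map_add, mul_add, ha, hb]
    | hg p' q' b hb =>
      rw [P.upUnit_left_apply r ha, P.upUnit_left_apply r hb]
      by_cases h : p = p'
      · subst h
        split_ifs <;> simp
      · have h0 := P.mul_eq_zero (hP ha) hb h
        split_ifs <;> simp [h0]

end Grading

/-! ### Norm and inner product on the tensor product -/

section TensorInner

variable {V H : Type*} [NormedAddCommGroup V] [InnerProductSpace ℂ V]
  [NormedAddCommGroup H] [InnerProductSpace ℂ H]

theorem tensor_inner_self (x : V ⊗[ℂ] H) : inner ℂ x x = ((‖x‖ : ℝ) : ℂ) ^ 2 :=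
  inner_self_eq_norm_sq_to_K (𝕜 := ℂ) x

theorem norm_tensor_inner_le (x y : V ⊗[ℂ] H) : ‖inner ℂ x y‖ ≤ ‖x‖ * ‖y‖ :=
  norm_inner_le_norm (𝕜 := ℂ) x y

end TensorInner

/-! ### Unitary modules and the action on `V ⊗ H` -/

section Modules

variable {A : Type*} [NonUnitalRing A] [Module ℂ A] [IsScalarTower ℂ A A] [SMulCommClass ℂ A A]
  [StarRing A] [StarModule ℂ A] {H : Type*} [NormedAddCommGroup H] [InnerProductSpace ℂ H]
  {φ : A →ₗ[ℂ] ℂ} {Λ : A ≃ₗ[ℂ] H}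
  {V : Type*} [NormedAddCommGroup V] [InnerProductSpace ℂ V]

namespace UnitaryModule

/-- The map `a ⊗ b ↦ a v ⊗ Λ(b)`. -/
def actTensor (M : UnitaryModule A V) (Λ : A ≃ₗ[ℂ] H) (v : V) : A ⊗[ℂ] A →ₗ[ℂ] V ⊗[ℂ] H :=
  TensorProduct.map ((M.act : A →ₗ[ℂ] Module.End ℂ V).flip v) Λ.toLinearMap

@[simp] theorem actTensor_tmul (M : UnitaryModule A V) (v : V) (a b : A) :
    M.actTensor Λ v (a ⊗ₜ b) = M.act a v ⊗ₜ Λ b := rfl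

theorem inner_act_act (M : UnitaryModule A V) (a b : A) (v w : V) :
    inner ℂ (M.act a v) (M.act b w) = inner ℂ v (M.act (star a * b) w) := by
  rw [map_mul, Module.End.mul_apply, M.inner_act (star a), star_star]

/-- Inner products in `V ⊗ H` become slices by `φ`, which is the form to which left invariance
applies. -/
theorem inner_actTensor (M : UnitaryModule A V)
    (hΛ : ∀ a b, inner ℂ (Λ a) (Λ b) = φ (star a * b)) (v w : V) (x y : A ⊗[ℂ] A) :
    inner ℂ (M.actTensor Λ v x) (M.actTensor Λ w y) =
      inner ℂ v (M.act (sliceSnd φ (star x * y)) w) := by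
  induction x with
  | zero => simp
  | add u v hu hv =>
    simp only [add_mul, star_add, map_add, inner_add_left, inner_add_right, hu, hv,
      LinearMap.add_apply]
  | tmul a b =>
    induction y with
    | zero => simp
    | add u v hu hv => simp only [mul_add, map_add, inner_add_right, hu, hv, LinearMap.add_apply]
    | tmul c d => simp [hΛ, inner_act_act, mul_comm]

/-- Since `⟨Λ(b*), Λ d⟩ = φ(b d)`, pairing the second leg with `Λ(b*)` is slicing by `φ(b ·)`. -/
theorem inner_tmul_actTensor (M : UnitaryModule A V)
    (hΛ : ∀ a b, inner ℂ (Λ a) (Λ b) = φ (star a * b)) (v w : V) (b : A) (y : A ⊗[ℂ] A) :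
    inner ℂ (v ⊗ₜ Λ (star b)) (M.actTensor Λ w y) =
      inner ℂ v (M.act (sliceSnd φ (TensorProduct.map LinearMap.id (LinearMap.mulLeft ℂ b) y)) w)
      := by
  induction y with
  | zero => simp
  | add u v hu hv => simp only [map_add, inner_add_right, hu, hv, LinearMap.add_apply]
  | tmul c d => simp [hΛ, mul_comm]

theorem exists_eq_sum_act (M : UnitaryModule A V) (v : V) :
    ∃ (n : ℕ) (a : Fin n → A) (w : Fin n → V), v = ∑ i, M.act (a i) (w i) := by
  have hv : v ∈ Submodule.span ℂ {x : V | ∃ a v, x = M.act a v} := by rw [M.unital]; trivial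
  obtain ⟨n, f, g, rfl⟩ := Submodule.mem_span_set'.1 hv
  choose a w h using fun i => (g i).2
  exact ⟨n, fun i => f i • a i, w, by simp [h]⟩

end UnitaryModule

end Modules

/-! ### Boundedness of the action -/

section Boundedness

variable {I A : Type*} [NonUnitalRing A] [Module ℂ A] [IsScalarTower ℂ A A]
  [SMulCommClass ℂ A A] [StarRing A] [StarModule ℂ A]
  {H : Type*} [NormedAddCommGroup H] [InnerProductSpace ℂ H]
  {φ : A →ₗ[ℂ] ℂ} {Λ : A ≃ₗ[ℂ] H}
  {V : Type*} [NormedAddCommGroup V] [InnerProductSpace ℂ V]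

/-- `(id ⊗ φ)((Δ(c)(a ⊗ 1))* Δ(c)(b ⊗ 1)) = φ(c* c) a* 𝟏^q b` for homogeneous `c` with upper right
index `q`. -/
theorem PartialMultiplierHopfStarAlgebra.sliceSnd_star_mul
    (Q : PartialMultiplierHopfStarAlgebra I A) (hφ : Q.IsLeftInvariant φ)
    (hΛ : ∀ a b, inner ℂ (Λ a) (Λ b) = φ (star a * b)) {p q : I × I} {c : A}
    (hc : c ∈ Q.grade p q) {a b : A} {x y : A ⊗[ℂ] A}
    (hx : Multiplier.ofElem x = Q.comul c * Multiplier.tmul (Multiplier.ofElem a) 1)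
    (hy : Multiplier.ofElem y = Q.comul c * Multiplier.tmul (Multiplier.ofElem b) 1) :
    sliceSnd φ (star x * y) = φ (star c * c) • (star a * (Q.upUnit q.1).left b) := by
  classical
  obtain ⟨⟨w, hw, hm⟩, -⟩ := (hφ.2 (star c * c)).1 b
  -- With `w = Δ(c* c)(b ⊗ 1)`, both sides are `(a* ⊗ 1)Δ(c* c)(b ⊗ 1)`. As `Δ(c)` is only a
  -- multiplier, they are compared after multiplication by an arbitrary `u` from the left.
  have key : star x * y = TensorProduct.map (LinearMap.mulLeft ℂ (star a)) LinearMap.id w := by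
    refine tensor_ext_of_mul_left hΛ fun u => ?_
    have h1 : u * star x =
        (Q.comul (star c)).right (TensorProduct.map (LinearMap.mulRight ℂ (star a))
          LinearMap.id u) := by
      have e : TensorProduct.map (LinearMap.mulRight ℂ (star a)) LinearMap.id u =
          star (TensorProduct.map (LinearMap.mulLeft ℂ a) LinearMap.id (star u)) := by
        rw [star_map_mulLeft, star_star]
      rw [(Q.comul_star c).2, e, star_star, ← mul_eq_of_ofElem_eq_mul_tmul_one' hx,
        star_mul_tensor, star_star]
    rw [← mul_assoc, h1, mul_eq_of_ofElem_eq_mul_tmul_one hy, mul_map_mulLeft_fst,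
      mul_eq_of_ofElem_eq_mul_tmul_one hw, map_mul]
    rfl
  have hcc : star c * c ∈ Q.grade q q := Q.mul_mem (Q.star_mem hc) hc
  -- In `∑ r, φ(𝟏^r c* c) 𝟏^r` only `r = q.1` survives, because `c* c` lies in `grade q q`.
  have hd : (Q.diag fun p => φ ((Q.upUnit p.1).left (star c * c))).left b =
      φ (star c * c) • (Q.upUnit q.1).left b := by
    clear hy hw hm key
    induction b using Q.induction_grade with
    | h0 => simp
    | hadd a b ha hb => simp only [map_add, smul_add, ha, hb]
    | hg r s b hb =>
      rw [Q.diag_left _ hb, Q.upUnit_left_apply _ hb, Q.upUnit_left_apply _ hcc]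
      by_cases h : r.1 = q.1
      · simp [h]
      · simp [h, Ne.symm h]
  rw [key, sliceSnd_map_mulLeft, ← hm, hd, mul_smul_comm]

/-- The vector `Δ(c)(v ⊗ 1)`, where `v = ∑ aᵢ vᵢ`, has norm at most `‖Λ c‖ ‖v‖`. -/
theorem PartialMultiplierHopfStarAlgebra.norm_sum_actTensor_le
    (Q : PartialMultiplierHopfStarAlgebra I A) (hφ : Q.IsLeftInvariant φ)
    (hΛ : ∀ a b, inner ℂ (Λ a) (Λ b) = φ (star a * b)) (M : UnitaryModule A V) {p q : I × I}
    {c : A} (hc : c ∈ Q.grade p q) {ι : Type*} [Fintype ι] (a : ι → A) (w : ι → V)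
    (z : ι → A ⊗[ℂ] A)
    (hz : ∀ i, Multiplier.ofElem (z i) =
      Q.comul c * Multiplier.tmul (Multiplier.ofElem (a i)) 1) :
    ‖∑ i, M.actTensor Λ (w i) (z i)‖ ≤ ‖Λ c‖ * ‖∑ i, M.act (a i) (w i)‖ := by
  set e := (Q.upUnit q.1).left with he
  set v := ∑ i, M.act (a i) (w i) with hv
  set v' := ∑ i, M.act (e (a i)) (w i) with hv'
  -- Formally `v' = 𝟏^q v`. The base unit is a self-adjoint idempotent, so both sides are `∑ ⟨wᵢ,
  -- aᵢ* 𝟏^q aⱼ wⱼ⟩`.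
  have h1 : inner ℂ v v' = inner ℂ v' v' := by
    simp only [hv, hv', sum_inner, inner_sum, M.inner_act_act]
    refine Finset.sum_congr rfl fun i _ => Finset.sum_congr rfl fun j _ => ?_
    rw [he, Q.star_upUnit_left_mul Q.star_mem, Q.upUnit_left_idem]
  have h2 : inner ℂ (∑ i, M.actTensor Λ (w i) (z i)) (∑ i, M.actTensor Λ (w i) (z i)) =
      φ (star c * c) * inner ℂ v v' := by
    simp only [hv, hv', sum_inner, inner_sum, M.inner_actTensor hΛ, M.inner_act_act,
      Finset.mul_sum]
    refine Finset.sum_congr rfl fun i _ => Finset.sum_congr rfl fun j _ => ?_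
    rw [Q.sliceSnd_star_mul hφ hΛ hc (hz j) (hz i), map_smul, LinearMap.smul_apply,
      inner_smul_right]
  have h3 : ‖v'‖ ≤ ‖v‖ := by
    have h4 : ‖v'‖ * ‖v'‖ ≤ ‖v‖ * ‖v'‖ := by
      rw [← inner_self_eq_norm_mul_norm (𝕜 := ℂ), ← h1]
      exact (Complex.re_le_norm _).trans (norm_inner_le_norm _ _)
    by_contra! h
    nlinarith [norm_nonneg v]
  -- As `φ(c* c) = ‖Λ c‖²`, the squared norm in question is `‖Λ c‖² ‖v'‖²`.
  rw [← hΛ, h1] at h2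
  have h5 := congrArg norm h2
  rw [norm_mul, tensor_inner_self, inner_self_eq_norm_sq_to_K, inner_self_eq_norm_sq_to_K] at h5
  simp only [norm_pow, RCLike.norm_ofReal, Complex.norm_real, norm_norm, abs_norm, ← mul_pow] at h5
  refine (pow_le_pow_iff_left₀ (norm_nonneg _) (by positivity) two_ne_zero).1 ?_
  rw [h5]
  gcongr

/-- The elements `(id ⊗ φ)((1 ⊗ b) Δ(c))` act by bounded operators. -/
theorem PartialMultiplierHopfStarAlgebra.norm_act_sliceSnd_le
    (Q : PartialMultiplierHopfStarAlgebra I A) (hφ : Q.IsLeftInvariant φ)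
    (hΛ : ∀ a b, inner ℂ (Λ a) (Λ b) = φ (star a * b)) (M : UnitaryModule A V) {p q : I × I}
    {b c : A} (hc : c ∈ Q.grade p q) {u : A ⊗[ℂ] A}
    (hu : Multiplier.ofElem u = Multiplier.tmul 1 (Multiplier.ofElem b) * Q.comul c) (v : V) :
    ‖M.act (sliceSnd φ u) v‖ ≤ ‖Λ (star b)‖ * ‖Λ c‖ * ‖v‖ := by
  obtain ⟨n, a, w, hv⟩ := M.exists_eq_sum_act v
  choose z hz using fun i => ((Q.comul_restricted c).2.2 (a i)).1
  -- Both sides are the slice of `(1 ⊗ b)Δ(c)(aᵢ ⊗ 1)`, bracketed in two ways.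
  have h1 : ∀ i, sliceSnd φ u * a i =
      sliceSnd φ (TensorProduct.map LinearMap.id (LinearMap.mulLeft ℂ b) (z i)) := by
    intro i
    rw [← sliceSnd_map_mulRight]
    congr 1
    refine tensor_ext_of_mul_left hΛ fun y => ?_
    rw [mul_map_mulRight_fst, mul_eq_of_ofElem_eq_one_tmul_mul hu, mul_map_mulLeft_snd,
      mul_eq_of_ofElem_eq_mul_tmul_one (hz i)]
  -- With `T v` itself as test vector, Cauchy–Schwarz in `V ⊗ H` bounds `‖T v‖²` by `‖T v‖` times
  -- the constant; no completeness of `V` is needed.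
  have h2 : inner ℂ (M.act (sliceSnd φ u) v) (M.act (sliceSnd φ u) v) =
      inner ℂ (M.act (sliceSnd φ u) v ⊗ₜ[ℂ] Λ (star b)) (∑ i, M.actTensor Λ (w i) (z i)) := by
    rw [inner_sum]
    simp only [M.inner_tmul_actTensor hΛ, ← h1, map_mul, Module.End.mul_apply]
    rw [← inner_sum, ← map_sum, ← hv]
  have h3 := Q.norm_sum_actTensor_le hφ hΛ M hc a w z hz
  rw [← hv] at h3
  set x := M.act (sliceSnd φ u) v
  have h4 : ‖x‖ * ‖x‖ ≤ ‖x‖ * (‖Λ (star b)‖ * ‖Λ c‖ * ‖v‖) := by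
    rw [← inner_self_eq_norm_mul_norm (𝕜 := ℂ), h2]
    refine (Complex.re_le_norm _).trans ((norm_tensor_inner_le _ _).trans ?_)
    rw [TensorProduct.norm_tmul, mul_assoc, mul_assoc]
    gcongr
  rcases (norm_nonneg x).eq_or_lt with h | h
  · rw [← h]; positivity
  · exact le_of_mul_le_mul_left h4 h

/-- The canonical map `b ⊗ c ↦ (b ⊗ 1) Δᵒᵖ(c)` takes values in `A ⊗ A`, and the image under
`φ ⊗ id` of every value acts by a bounded operator. -/
theorem PartialMultiplierHopfStarAlgebra.exists_canLeft_comulOp_bounded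
    (Q : PartialMultiplierHopfStarAlgebra I A) (hφ : Q.IsLeftInvariant φ)
    (hΛ : ∀ a b, inner ℂ (Λ a) (Λ b) = φ (star a * b)) (M : UnitaryModule A V)
    (t : A ⊗[ℂ] A) :
    ∃ u : A ⊗[ℂ] A, Multiplier.ofElem u = canLeft (comulOp Q.comul) t ∧
      ∃ C : ℝ, ∀ v, ‖M.act (sliceFst φ u) v‖ ≤ C * ‖v‖ := by
  induction t with
  | zero => exact ⟨0, by simp, 0, by simp⟩
  | add x y hx hy =>
    obtain ⟨u, hu, C, hC⟩ := hx
    obtain ⟨u', hu', C', hC'⟩ := hy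
    refine ⟨u + u', by rw [map_add, map_add, hu, hu'], C + C', fun v => ?_⟩
    rw [map_add, map_add, LinearMap.add_apply, add_mul]
    exact (norm_add_le _ _).trans (add_le_add (hC v) (hC' v))
  | tmul b c =>
    -- The norm estimate is available for homogeneous `c`; sums add their constants.
    induction c using Q.induction_grade with
    | h0 => exact ⟨0, by simp, 0, by simp⟩
    | hadd x y hx hy =>
      obtain ⟨u, hu, C, hC⟩ := hx
      obtain ⟨u', hu', C', hC'⟩ := hy
      refine ⟨u + u', by rw [TensorProduct.tmul_add, map_add, map_add, hu, hu'], C + C',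
        fun v => ?_⟩
      rw [map_add, map_add, LinearMap.add_apply, add_mul]
      exact (norm_add_le _ _).trans (add_le_add (hC v) (hC' v))
    | hg p q c hc =>
      obtain ⟨u, hu⟩ := ((Q.comul_restricted c).2.2 b).2.2.2
      -- The flip takes `(1 ⊗ b)Δ(c)` to `(b ⊗ 1)Δᵒᵖ(c)` and the slice over the second leg to the
      -- slice over the first.
      refine ⟨TensorProduct.comm ℂ A A u, ?_, ‖Λ (star b)‖ * ‖Λ c‖, fun v => ?_⟩
      · have hswap : ∀ y : A ⊗[ℂ] A,
            TensorProduct.comm ℂ A A (TensorProduct.map LinearMap.id (LinearMap.mulLeft ℂ b) y) =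
            TensorProduct.map (LinearMap.mulLeft ℂ b) LinearMap.id (TensorProduct.comm ℂ A A y) :=
          fun y => TensorProduct.map_comm _ _ y |>.symm
        have hswap' : ∀ y : A ⊗[ℂ] A,
            TensorProduct.comm ℂ A A (TensorProduct.map (LinearMap.mulRight ℂ b) LinearMap.id y) =
            TensorProduct.map LinearMap.id (LinearMap.mulRight ℂ b) (TensorProduct.comm ℂ A A y) :=
          fun y => TensorProduct.map_comm _ _ y |>.symm
        ext y
        · have h : u * TensorProduct.comm ℂ A A y = TensorProduct.map LinearMap.id
              (LinearMap.mulLeft ℂ b) ((Q.comul c).left (TensorProduct.comm ℂ A A y)) :=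
            congrArg (fun m : Multiplier (A ⊗[ℂ] A) => m.left (TensorProduct.comm ℂ A A y)) hu
          have h' := congrArg (TensorProduct.comm ℂ A A) h
          rw [comm_mul, hswap, TensorProduct.comm_comm] at h'
          exact h'
        · have h : TensorProduct.comm ℂ A A y * u = (Q.comul c).right (TensorProduct.map
              LinearMap.id (LinearMap.mulRight ℂ b) (TensorProduct.comm ℂ A A y)) :=
            congrArg (fun m : Multiplier (A ⊗[ℂ] A) => m.right (TensorProduct.comm ℂ A A y)) hu
          have h' := congrArg (TensorProduct.comm ℂ A A) h
          rw [comm_mul, TensorProduct.comm_comm, ← hswap'] at h'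
          exact h'
      · rw [sliceFst_comm]
        exact Q.norm_act_sliceSnd_le hφ hΛ M hc hu v

theorem PartialAlgebra.grade_le_upRight (P : PartialAlgebra (I × I) A) (p q : I × I) :
    P.grade p q ≤ P.upRight q.1 :=
  (le_iSup (fun p => P.grade p q) p).trans (le_iSup (fun u => P.col (q.1, u)) q.2)

theorem PartialAlgebra.grade_le_lowRight (P : PartialAlgebra (I × I) A) (p q : I × I) :
    P.grade p q ≤ P.lowRight q.2 :=
  (le_iSup (fun p => P.grade p q) p).trans (le_iSup (fun s => P.col (s, q.2)) q.1)

theorem PartialAlgebra.mul_mem_upRight (P : PartialAlgebra (I × I) A) {p q : I × I} {a : A}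
    (ha : a ∈ P.grade p q) (b : A) : b * a ∈ P.upRight q.1 := by
  induction b using P.induction_grade with
  | h0 => simp
  | hadd x y hx hy => rw [add_mul]; exact add_mem hx hy
  | hg r s b hb =>
    by_cases h : s = p
    · subst h
      exact P.grade_le_upRight _ _ (P.mul_mem hb ha)
    · rw [P.mul_eq_zero hb ha h]
      exact zero_mem _

/-- A faithful functional does not vanish on the elements with upper right index `r`. -/
theorem RegularPartialMultiplierBialgebra.exists_mem_upRight_apply_ne_zero
    (Q : RegularPartialMultiplierBialgebra I A) (hf : IsFaithful φ) (r : I) :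
    ∃ y ∈ Q.upRight r, φ y ≠ 0 := by
  obtain ⟨a, ha, hε⟩ := (Q.counit_ne_zero r).1
  obtain ⟨s, p, a, ha, hε⟩ : ∃ (s : I) (p : I × I), ∃ a ∈ Q.grade p (s, r), Q.counit a ≠ 0 := by
    by_contra! h
    refine hε ?_
    have hle : Q.lowRight r ≤ LinearMap.ker Q.counit :=
      iSup_le fun s => iSup_le fun p => fun a ha => h s p a ha
    exact hle ha
  obtain ⟨p₁, p₂⟩ := p
  -- The counit lives on equal upper and lower right indices, so an element found through its lower
  -- index also has upper right index `r`.
  have hs : s = r := by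
    by_contra hs
    exact hε (Q.counit_eq_zero p₁ s p₂ r (Or.inr hs) a ha)
  subst hs
  have ha0 : a ≠ 0 := by
    rintro rfl
    exact hε (map_zero _)
  by_contra! h
  -- Left multiples `b a` keep the right index of `a`; were `φ` zero on all of them, faithfulness
  -- would force `a = 0`.
  exact ha0 (hf.2 a fun b => h _ (Q.mul_mem_upRight ha b))

/-- A partial `*`-algebraic quantum group acts on unitary modules by bounded operators. -/
theorem PartialStarAlgebraicQuantumGroup.exists_norm_act_le
    (Q : PartialStarAlgebraicQuantumGroup I A) (M : UnitaryModule A V) (a : A) :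
    ∃ C : ℝ, ∀ v : V, ‖M.act a v‖ ≤ C * ‖v‖ := by
  obtain ⟨φ, hφ, hf, hpos⟩ := Q.exists_integral
  obtain ⟨H, _, _, Λ, hΛ⟩ := exists_gns hf hpos
  induction a using Q.induction_grade with
  | h0 => exact ⟨0, by simp⟩
  | hadd a b ha hb =>
    obtain ⟨C, hC⟩ := ha
    obtain ⟨C', hC'⟩ := hb
    refine ⟨C + C', fun v => ?_⟩
    rw [map_add, LinearMap.add_apply, add_mul]
    exact (norm_add_le _ _).trans (add_le_add (hC v) (hC' v))
  | hg p q x hx =>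
    -- The index is the lower right one of `x`, which puts `y ⊗ x` in the range of the canonical map
    -- `can_lc`.
    obtain ⟨y, hy, hy0⟩ := Q.exists_mem_upRight_apply_ne_zero hf q.2
    have hyx : y ⊗ₜ[ℂ] x ∈ ⨆ r, tensorSub (Q.upRight r) (Q.lowRight r) :=
      Submodule.mem_iSup_of_mem q.2
        (Submodule.apply_mem_map₂ _ hy (Q.grade_le_lowRight p q hx))
    obtain ⟨t, -, ht⟩ := Q.can_lc.surjOn ⟨_, hyx, rfl⟩
    obtain ⟨u, hu, C, hC⟩ := Q.exists_canLeft_comulOp_bounded hφ hΛ M t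
    have huyx : u = y ⊗ₜ x := by
      rw [ht] at hu
      exact tensor_ext_of_mul_left hΛ fun z =>
        congrArg (fun m : Multiplier (A ⊗[ℂ] A) => m.right z) hu
    -- Slicing `y ⊗ x` gives `φ(y) x`, bounded by `C`; dividing by `φ(y)` gives the constant for
    -- `x`.
    refine ⟨‖(φ y)⁻¹‖ * C, fun v => ?_⟩
    have h := hC v
    rw [huyx, sliceFst_tmul, map_smul, LinearMap.smul_apply, norm_smul] at h
    rw [norm_inv, mul_assoc, ← div_eq_inv_mul, le_div_iff₀' (norm_pos_iff.2 hy0)]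
    exact h

end Boundedness

/-! ### Existence and uniqueness of the completion -/

section Completions

variable {A : Type*} [NonUnitalRing A] [Module ℂ A] [IsScalarTower ℂ A A] [SMulCommClass ℂ A A]
  [StarRing A] [StarModule ℂ A]
  {V : Type*} [NormedAddCommGroup V] [InnerProductSpace ℂ V]

namespace UnitaryModule

open UniformSpace

variable (M : UnitaryModule A V) (hM : ∀ a : A, ∃ C : ℝ, ∀ v : V, ‖M.act a v‖ ≤ C * ‖v‖)

/-- The extension of the bounded operator `a` on `V` to the completion of `V`. -/
def actCompletion (a : A) : Completion V →L[ℂ] Completion V :=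
  ((M.act a).mkContinuousOfExistsBound (hM a)).completion

theorem actCompletion_coe (a : A) (v : V) :
    M.actCompletion hM a (v : Completion V) = (M.act a v : V) := by
  simp [actCompletion]

theorem completion_clm_ext {f g : Completion V →L[ℂ] Completion V}
    (h : ∀ v : V, f v = g v) : f = g := by
  ext x
  induction x using Completion.induction_on with
  | hp => exact isClosed_eq f.continuous g.continuous
  | ih v => exact h v

/-- The `*`-representation on the completion of a unitary module with bounded action. -/
def completionRepresentation : StarRepresentation A (Completion V) where
  hom :=
    { toFun := M.actCompletion hM
      map_smul' := fun c a => completion_clm_ext fun v => by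
        simp [actCompletion_coe, ← Completion.coe_smul]
      map_zero' := completion_clm_ext fun v => by simp [actCompletion_coe]
      map_add' := fun a b => completion_clm_ext fun v => by
        simp [actCompletion_coe, ← Completion.coe_add]
      map_mul' := fun a b => completion_clm_ext fun v => by
        simp [actCompletion_coe]
      map_star' := fun a => by
        refine (ContinuousLinearMap.eq_adjoint_iff _ _).2 fun x y => ?_
        induction x, y using Completion.induction_on₂ with
        | hp => exact isClosed_eq (by fun_prop) (by fun_prop)
        | ih v w =>
          rw [actCompletion_coe, actCompletion_coe, Completion.inner_coe, Completion.inner_coe,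
            M.inner_act] }
  dense := by
    -- Since `AV = V`, the span already contains the dense image of `V`.
    refine Completion.denseRange_coe.mono ?_
    rintro _ ⟨v, rfl⟩
    obtain ⟨n, a, w, rfl⟩ := M.exists_eq_sum_act v
    change Completion.toComplₗᵢ (𝕜 := ℂ) (∑ i, M.act (a i) (w i)) ∈ _
    rw [map_sum]
    exact sum_mem fun i _ => Submodule.subset_span
      ⟨a i, (w i : Completion V), (M.actCompletion_coe hM (a i) (w i)).symm⟩

theorem isCompletion_completionRepresentation :
    M.IsCompletion (M.completionRepresentation hM) Completion.toComplₗᵢ :=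
  ⟨Completion.denseRange_coe, M.actCompletion_coe hM⟩

variable {M}

theorem IsCompletion.unique {R R' : StarRepresentation A (Completion V)}
    (h : M.IsCompletion R Completion.toComplₗᵢ) (h' : M.IsCompletion R' Completion.toComplₗᵢ) :
    R = R' := by
  obtain ⟨f, hf⟩ := R
  obtain ⟨g, hg⟩ := R'
  congr 1
  ext1 a
  exact completion_clm_ext fun v => (h.2 a v).trans (h'.2 a v).symm

/-- The identity of `V` extends to a unitary between the two completions. Intertwining holds on the
dense image of `V`, hence everywhere by continuity; uniqueness follows from the values on that image
alone. -/
theorem IsCompletion.existsUnique_isometryEquiv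
    {H₁ : Type*} [NormedAddCommGroup H₁] [InnerProductSpace ℂ H₁] [CompleteSpace H₁]
    {H₂ : Type*} [NormedAddCommGroup H₂] [InnerProductSpace ℂ H₂] [CompleteSpace H₂]
    {R₁ : StarRepresentation A H₁} {j₁ : V →ₗᵢ[ℂ] H₁}
    {R₂ : StarRepresentation A H₂} {j₂ : V →ₗᵢ[ℂ] H₂}
    (h₁ : M.IsCompletion R₁ j₁) (h₂ : M.IsCompletion R₂ j₂) :
    ∃! U : H₁ ≃ₗᵢ[ℂ] H₂,
      (∀ v : V, U (j₁ v) = j₂ v) ∧ ∀ (a : A) (ξ : H₁), U (R₁.hom a ξ) = R₂.hom a (U ξ) := by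
  have hnorm : ∀ v : V, ‖j₂.toLinearMap (LinearEquiv.refl ℂ V v)‖ = ‖j₁.toLinearMap v‖ := by
    simp
  let U : H₁ ≃ₗᵢ[ℂ] H₂ := (LinearEquiv.refl ℂ V).extendOfIsometry j₁.toLinearMap j₂.toLinearMap
    h₁.1 h₂.1 hnorm
  have hU : ∀ v, U (j₁ v) = j₂ v := fun v =>
    LinearEquiv.extendOfIsometry_eq (LinearEquiv.refl ℂ V) j₁.toLinearMap j₂.toLinearMap
      h₁.1 h₂.1 hnorm v
  refine ⟨U, ⟨hU, fun a ξ => ?_⟩, fun U' hU' => ?_⟩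
  · have h := h₁.1.equalizer (U.continuous.comp (R₁.hom a).continuous)
      ((R₂.hom a).continuous.comp U.continuous) (by
        funext v
        simp only [Function.comp_apply]
        rw [h₁.2, hU, hU, h₂.2])
    exact congrFun h ξ
  · have h := h₁.1.equalizer U'.continuous U.continuous (by
      funext v
      exact (hU'.1 v).trans (hU v).symm)
    exact LinearIsometryEquiv.ext (congrFun h)

end UnitaryModule

end Completions

end

end PartialQG

theorem mainTheorem12 {I A : Type*} [NonUnitalRing A] [Module ℂ A] [IsScalarTower ℂ A A]
    [SMulCommClass ℂ A A] [StarRing A] [StarModule ℂ A]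
    (Q : PartialQG.PartialStarAlgebraicQuantumGroup I A)
    {V : Type*} [NormedAddCommGroup V] [InnerProductSpace ℂ V] (M : PartialQG.UnitaryModule A V) :
    (∀ a : A, ∃ C : ℝ, ∀ v : V, ‖M.act a v‖ ≤ C * ‖v‖) ∧
    (∃! R : PartialQG.StarRepresentation A (UniformSpace.Completion V),
      M.IsCompletion R UniformSpace.Completion.toComplₗᵢ) ∧
    (∀ {H₁ : Type*} [NormedAddCommGroup H₁] [InnerProductSpace ℂ H₁] [CompleteSpace H₁]
      {H₂ : Type*} [NormedAddCommGroup H₂] [InnerProductSpace ℂ H₂] [CompleteSpace H₂]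
      (R₁ : PartialQG.StarRepresentation A H₁) (j₁ : V →ₗᵢ[ℂ] H₁)
      (R₂ : PartialQG.StarRepresentation A H₂) (j₂ : V →ₗᵢ[ℂ] H₂),
      M.IsCompletion R₁ j₁ → M.IsCompletion R₂ j₂ →
      ∃! U : H₁ ≃ₗᵢ[ℂ] H₂,
        (∀ v : V, U (j₁ v) = j₂ v) ∧ ∀ (a : A) (ξ : H₁), U (R₁.hom a ξ) = R₂.hom a (U ξ)) := by
  have hM := Q.exists_norm_act_le M
  refine ⟨hM, ⟨M.completionRepresentation hM, M.isCompletion_completionRepresentation hM,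
    fun R hR => hR.unique (M.isCompletion_completionRepresentation hM)⟩, ?_⟩
  intro H₁ _ _ _ H₂ _ _ _ R₁ j₁ R₂ j₂ h₁ h₂
  exact h₁.existsUnique_isometryEquiv h₂
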